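/- A continuous function $f:\mathbb R\to\mathbb C$ is called almost automorphic ($f\in\mathcal C_{aa}$) if every real sequence $(s_m)_m$ has a subsequence $(s_{m_k})_k$ such that $g(x):=\lim_{k\to\infty}f(x+s_{m_k})$ exists for every $x\in\mathbb R$ and $\lim_{k\to\infty}g(x-s_{m_k})=f(x)$ for every $x\in\mathbb R$. Let $\mathcal D$ be the space of smooth compactly supported functions $\mathbb R\to\mathbb C$, and let $\mathcal D_{L^1}$ be the space of smooth functions $\varphi:\mathbb R\to\mathbb C$ all of whose derivatives belong to $L^1$, with the topology defined by the norms $|\varphi|_{m,1}=\sum_{i=0}^m\|\varphi^{(i)}\|_{L^1}$, $m=0,1,2,\dots$. The space $\mathcal D'_{L^\infty}$ of bounded distributions is the topological dual of $\mathcal D_{L^1}$. For $T\in\mathcal D'_{L^\infty}$ and $\varphi\in\mathcal D$ put $(T*\varphi)(x)=\langle T,\varphi(x-\cdot)\rangle$; the derivative of $T$ is given by $\langle T',\psi\rangle=-\langle T,\psi'\rangle$, and an almost automorphic function $f$ (which is necessarily bounded) is identified with the bounded distribution $\psi\mapsto\int_{\mathbb R}f\psi\,dx$. **Theorem.** For every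 $T\in\mathcal D'_{L^\infty}$ the following statements are equivalent: 1. $T*\varphi\in\mathcal C_{aa}$ for all $\varphi\in\mathcal D$. 2. There are an integer $k\ge 0$ and functions $f_0,\dots,f_k\in\mathcal C_{aa}$ such that $T=\sum_{j=0}^k f_j^{(j)}$, the derivatives being taken in the sense of distributions. -/

import Mathlib

open MeasureTheory Filter Topology
open scoped ContDiff Distributions

noncomputable section

/-- Almost automorphy in the sense of Bochner of a function `f : ℝ → ℂ`. -/
def AlmostAutomorphic (f : ℝ → ℂ) : Prop :=
  Continuous f ∧ ∀ s : ℕ → ℝ, ∃ n : ℕ → ℕ, StrictMono n ∧ ∃ g : ℝ → ℂ,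
    (∀ x, Tendsto (fun k => f (x + s (n k))) atTop (𝓝 (g x))) ∧
    (∀ x, Tendsto (fun k => g (x - s (n k))) atTop (𝓝 (f x)))

theorem AlmostAutomorphic.bounded {f : ℝ → ℂ} (hf : AlmostAutomorphic f) :
    ∃ C, ∀ x, ‖f x‖ ≤ C := by
  by_contra! h
  choose s hs using fun m : ℕ => h m
  obtain ⟨n, hn, g, hg, -⟩ := hf.2 s
  have h1 := (hg 0).norm
  have h2 : Tendsto (fun k => ‖f (0 + s (n k))‖) atTop atTop := by
    refine tendsto_atTop_mono (fun k => ?_)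
      (tendsto_natCast_atTop_atTop (R := ℝ).comp hn.tendsto_atTop)
    simpa using (hs (n k)).le
  exact not_tendsto_nhds_of_tendsto_atTop h2 _ h1

/-- The smooth functions `φ : ℝ → ℂ` all of whose derivatives belong to `L¹`. -/
def dL1Submodule : Submodule ℂ (ℝ → ℂ) where
  carrier := {φ | ContDiff ℝ ∞ φ ∧ ∀ i : ℕ, Integrable (iteratedDeriv i φ)}
  zero_mem' := by
    refine ⟨contDiff_const, fun i => ?_⟩
    have : iteratedDeriv i (0 : ℝ → ℂ) = 0 := by
      induction i with
      | zero => simp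
      | succ i ih => rw [iteratedDeriv_succ, ih]; ext; simp
    rw [this]
    exact integrable_zero _ _ _
  add_mem' := by
    rintro φ ψ ⟨hφ, hφ'⟩ ⟨hψ, hψ'⟩
    refine ⟨hφ.add hψ, fun i => ?_⟩
    have : iteratedDeriv i (φ + ψ) = iteratedDeriv i φ + iteratedDeriv i ψ := by
      ext x
      exact iteratedDeriv_add (hφ.contDiffAt.of_le (by exact_mod_cast le_top))
        (hψ.contDiffAt.of_le (by exact_mod_cast le_top))
    rw [this]
    exact (hφ' i).add (hψ' i)
  smul_mem' := by
    rintro c φ ⟨hφ, hφ'⟩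
    refine ⟨hφ.const_smul c, fun i => ?_⟩
    have : iteratedDeriv i (c • φ) = c • iteratedDeriv i φ := by
      ext x
      exact iteratedDeriv_const_smul_field c φ
    rw [this]
    exact (hφ' i).smul c

/-- The space `D_{L¹}` of smooth functions all of whose derivatives belong to `L¹`. It is a separate
type, so that it carries its own topology below, and not that of pointwise convergence. -/
def DL1 : Type := dL1Submodule

namespace DL1

instance : AddCommGroup DL1 := inferInstanceAs (AddCommGroup dL1Submodule)

instance : Module ℂ DL1 := inferInstanceAs (Module ℂ dL1Submodule)

instance : CoeFun DL1 (fun _ => ℝ → ℂ) := ⟨fun φ => φ.1⟩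

theorem contDiff (φ : DL1) : ContDiff ℝ ∞ φ := φ.2.1

theorem integrable (φ : DL1) (i : ℕ) : Integrable (iteratedDeriv i φ) := φ.2.2 i

theorem coe_add (φ ψ : DL1) : (φ + ψ : DL1) = (φ : ℝ → ℂ) + ψ := rfl

theorem coe_smul (c : ℂ) (φ : DL1) : (c • φ : DL1) = c • (φ : ℝ → ℂ) := rfl

theorem iteratedDeriv_add' (φ ψ : DL1) (i : ℕ) (x : ℝ) :
    iteratedDeriv i (φ + ψ : DL1) x = iteratedDeriv i φ x + iteratedDeriv i ψ x :=
  iteratedDeriv_add (φ.contDiff.contDiffAt.of_le (by exact_mod_cast le_top))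
    (ψ.contDiff.contDiffAt.of_le (by exact_mod_cast le_top))

theorem iteratedDeriv_smul' (c : ℂ) (φ : DL1) (i : ℕ) (x : ℝ) :
    iteratedDeriv i (c • φ : DL1) x = c * iteratedDeriv i φ x :=
  iteratedDeriv_const_smul_field c _

/-- The norm `|φ|_{m,1} = ∑_{i ≤ m} ‖φ^{(i)}‖_{L¹}`. -/
def norm (m : ℕ) : Seminorm ℂ DL1 :=
  Seminorm.of (fun φ => ∑ i ∈ Finset.range (m + 1), ∫ x, ‖iteratedDeriv i φ x‖)
    (fun φ ψ => by
      rw [← Finset.sum_add_distrib]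
      refine Finset.sum_le_sum fun i _ => ?_
      rw [← integral_add (φ.integrable i).norm (ψ.integrable i).norm]
      refine integral_mono ((φ + ψ).integrable i).norm
        ((φ.integrable i).norm.add (ψ.integrable i).norm) fun x => ?_
      simp only [iteratedDeriv_add']
      exact norm_add_le _ _)
    (fun c φ => by
      rw [Finset.mul_sum]
      refine Finset.sum_congr rfl fun i _ => ?_
      simp only [iteratedDeriv_smul', norm_mul, integral_const_mul])

theorem norm_apply (m : ℕ) (φ : DL1) :
    norm m φ = ∑ i ∈ Finset.range (m + 1), ∫ x, ‖iteratedDeriv i φ x‖ := rfl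

theorem integral_le_norm (φ : DL1) {i m : ℕ} (h : i ≤ m) :
    ∫ x, ‖iteratedDeriv i φ x‖ ≤ norm m φ := by
  rw [norm_apply]
  exact Finset.single_le_sum (f := fun i => ∫ x, ‖iteratedDeriv i φ x‖)
    (fun i _ => integral_nonneg fun x => norm_nonneg _) (Finset.mem_range.2 (by omega))

/-- The topology of `D_{L¹}` is the one defined by the norms `|·|_{m,1}`, `m ∈ ℕ`. -/
instance : TopologicalSpace DL1 := (SeminormFamily.moduleFilterBasis norm).topology'

theorem withSeminorms : WithSeminorms norm := ⟨rfl⟩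

instance : IsTopologicalAddGroup DL1 := withSeminorms.topologicalAddGroup

instance : ContinuousSMul ℂ DL1 := withSeminorms.continuousSMul

/-- The derivative `φ ↦ φ'` as a linear operator on `D_{L¹}`. -/
def derivLM : DL1 →ₗ[ℂ] DL1 where
  toFun φ := ⟨deriv φ, (contDiff_infty_iff_deriv.1 φ.contDiff).2, fun i => by
    rw [← iteratedDeriv_succ']; exact φ.integrable (i + 1)⟩
  map_add' φ ψ := Subtype.ext <| funext fun x => by
    have h := iteratedDeriv_add' φ ψ 1 x
    simp only [iteratedDeriv_one] at h
    exact h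
  map_smul' c φ := Subtype.ext <| funext fun x => by
    have h := iteratedDeriv_smul' c φ 1 x
    simp only [iteratedDeriv_one] at h
    exact h

/-- The derivative `φ ↦ φ'` as a continuous linear operator on `D_{L¹}`. -/
def derivCLM : DL1 →L[ℂ] DL1 where
  toLinearMap := derivLM
  cont := by
    refine WithSeminorms.continuous_of_isBounded withSeminorms withSeminorms
      derivLM fun m => ⟨{m + 1}, 1, fun φ => ?_⟩
    simp only [Finset.sup_singleton, one_smul]
    change norm m (derivLM φ) ≤ norm (m + 1) φ
    rw [norm_apply, norm_apply, Finset.sum_range_succ' _ (m + 1)]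
    simp only [iteratedDeriv_succ']
    exact le_add_of_nonneg_right (integral_nonneg fun x => norm_nonneg _)

@[simp] theorem derivCLM_apply (φ : DL1) (x : ℝ) : derivCLM φ x = deriv φ x := rfl

/-- The inclusion `D ⊆ D_{L¹}`. -/
def ofTestFunction (φ : 𝓓((⊤ : TopologicalSpace.Opens ℝ), ℂ)) : DL1 :=
  ⟨φ, φ.contDiff, fun i => by
    refine Continuous.integrable_of_hasCompactSupport
      (φ.contDiff.continuous_iteratedDeriv i (by exact_mod_cast le_top)) ?_
    induction i with
    | zero => simpa using φ.hasCompactSupport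
    | succ i ih => rw [iteratedDeriv_succ]; exact ih.deriv⟩

end DL1

/-- The space `D'_{L^∞}` of bounded distributions: the topological dual of `D_{L¹}`. -/
abbrev BoundedDistribution : Type := DL1 →L[ℂ] ℂ

namespace BoundedDistribution

/-- The derivative of a bounded distribution, `⟨T', ψ⟩ = -⟨T, ψ'⟩`. -/
def derivative (T : BoundedDistribution) : BoundedDistribution := -(T.comp DL1.derivCLM)

/-- The linear form `ψ ↦ ∫ f ψ` of a bounded continuous function `f`. -/
def ofFunLM (f : ℝ → ℂ) (hc : Continuous f) (hb : ∃ C, ∀ x, ‖f x‖ ≤ C) : DL1 →ₗ[ℂ] ℂ :=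
  have hint : ∀ ψ : DL1, Integrable (fun x => f x * ψ x) := fun ψ => by
    obtain ⟨C, hC⟩ := hb
    exact Integrable.bdd_mul (by simpa using ψ.integrable 0) hc.aestronglyMeasurable
      (Eventually.of_forall hC)
  { toFun := fun ψ => ∫ x, f x * ψ x
    map_add' := fun φ ψ => by
      simp only [DL1.coe_add, Pi.add_apply, mul_add]
      exact integral_add (hint φ) (hint ψ)
    map_smul' := fun c ψ => by
      simp only [DL1.coe_smul, Pi.smul_apply, smul_eq_mul, RingHom.id_apply, mul_left_comm _ c,
        integral_const_mul] }

/-- The bounded distribution `ψ ↦ ∫ f ψ` of a bounded continuous function `f`. -/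
def ofFun (f : ℝ → ℂ) (hc : Continuous f) (hb : ∃ C, ∀ x, ‖f x‖ ≤ C) : BoundedDistribution where
  toLinearMap := ofFunLM f hc hb
  cont := by
    obtain ⟨C, hC⟩ := id hb
    refine WithSeminorms.continuous_normedSpace_rng ℂ DL1.withSeminorms
      (ofFunLM f hc hb) ⟨{0}, C.toNNReal, fun ψ => ?_⟩
    have h0 : 0 ≤ C := (norm_nonneg _).trans (hC 0)
    simp only [Finset.sup_singleton]
    change ‖∫ x, f x * ψ x‖ ≤ C.toNNReal * DL1.norm 0 ψ
    rw [Real.coe_toNNReal _ h0]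
    refine le_trans ?_ (mul_le_mul_of_nonneg_left (ψ.integral_le_norm le_rfl) h0)
    rw [← integral_const_mul]
    refine norm_integral_le_of_norm_le ((ψ.integrable 0).norm.const_mul C)
      (Eventually.of_forall fun x => ?_)
    rw [norm_mul, iteratedDeriv_zero]
    exact mul_le_mul_of_nonneg_right (hC x) (norm_nonneg _)

/-- The convolution of a bounded distribution with a test function,
`(T * φ)(x) = ⟨T, φ(x - ·)⟩`. -/
def conv (T : BoundedDistribution) (φ : 𝓓((⊤ : TopologicalSpace.Opens ℝ), ℂ)) (x : ℝ) : ℂ :=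
  T (DL1.ofTestFunction
    { toFun := fun y => φ (x - y)
      contDiff' := φ.contDiff.comp (contDiff_const.sub contDiff_id)
      hasCompactSupport' := φ.hasCompactSupport.comp_homeomorph (Homeomorph.subLeft x)
      tsupport_subset' := fun _ _ => trivial })

end BoundedDistribution

/-- The bounded distribution of an almost automorphic function. -/
def AlmostAutomorphic.toDistribution {f : ℝ → ℂ} (hf : AlmostAutomorphic f) :
    BoundedDistribution :=
  BoundedDistribution.ofFun f hf.1 hf.bounded

end

/-! By continuity, `T` is bounded by a single norm `|·|_{m,1}`, so it has finite order `m`. On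
`D_{L¹}` the operator `1 - d/dx` has a continuous inverse `R`, an integral operator with kernel
`e^{-t} 1_{t > 0}`, and `R` gains one derivative (`norm_succ_resolventLM_le`). By duality `T ∘ R` is
`(1 + d/dx)⁻¹ T`: its order is one less, and it is still almost automorphic because `R` commutes
with translations.

At order zero `T` extends to `L¹`, and `(1 + d/dx)⁻¹ T` is the function `x ↦ T(expKernel (x - ·))`.
Approximating the kernel in `L¹` by test functions makes it a uniform limit of functions `T * η`,
hence almost automorphic (`exists_comp_resolvent_eq`). Thus `T = (1 + d/dx)^{m+1} f`, and the
binomial formula gives the representation.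

Conversely, dominated convergence handles `f * φ`, and `T' * φ = T * φ'` handles derivatives. -/

noncomputable section

/-! ### The inverse of `1 - d/dx` on integrable functions -/

/-- The fundamental solution `e^{-t} 1_{t > 0}` of `1 + d/dt`. -/
def expKernel : ℝ → ℂ := (Set.Ioi 0).indicator fun t => (Real.exp (-t) : ℂ)

theorem integrable_expKernel : Integrable expKernel := by
  rw [expKernel, integrable_indicator_iff measurableSet_Ioi]
  exact (integrableOn_exp_neg_Ioi 0).ofReal

theorem integral_norm_expKernel : ∫ t, ‖expKernel t‖ = 1 := by
  have h : (fun t => ‖expKernel t‖) = (Set.Ioi 0).indicator fun t => Real.exp (-t) := by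
    ext t
    by_cases ht : t ∈ Set.Ioi (0 : ℝ)
    · simp only [expKernel, Set.indicator_of_mem ht, Complex.norm_real, Real.norm_eq_abs,
        Real.abs_exp]
    · simp only [expKernel, Set.indicator_of_notMem ht, norm_zero]
  rw [h, integral_indicator measurableSet_Ioi, integral_exp_neg_Ioi_zero]

/-- The solution `u` of `u - u' = ψ` that is integrable when `ψ` is. -/
def expResolvent (ψ : ℝ → ℂ) (y : ℝ) : ℂ := ∫ x, expKernel (x - y) * ψ x

theorem expResolvent_eq_integral_add (ψ : ℝ → ℂ) (y : ℝ) :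
    expResolvent ψ y = ∫ t, expKernel t * ψ (y + t) := by
  rw [expResolvent, ← integral_add_right_eq_self _ y]
  simp [add_comm]

theorem expResolvent_eq_setIntegral (ψ : ℝ → ℂ) (y : ℝ) :
    expResolvent ψ y = (Real.exp y : ℂ) * ∫ s in Set.Ioi y, (Real.exp (-s) : ℂ) * ψ s := by
  rw [expResolvent, ← integral_const_mul, ← integral_indicator measurableSet_Ioi]
  congr 1
  ext x
  by_cases hx : y < x
  · rw [Set.indicator_of_mem (show x ∈ Set.Ioi y from hx), expKernel,
      Set.indicator_of_mem (show x - y ∈ Set.Ioi (0 : ℝ) from sub_pos.2 hx), ← mul_assoc,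
      ← Complex.ofReal_mul, ← Real.exp_add]
    congr 3
    ring
  · rw [Set.indicator_of_notMem (show x ∉ Set.Ioi y from hx), expKernel,
      Set.indicator_of_notMem (show x - y ∉ Set.Ioi (0 : ℝ) from fun h => hx (sub_pos.1 h)),
      zero_mul]

theorem integrableOn_exp_neg_mul {ψ : ℝ → ℂ} (hψ : Integrable ψ) (a : ℝ) :
    IntegrableOn (fun s => (Real.exp (-s) : ℂ) * ψ s) (Set.Ioi a) := by
  refine Integrable.bdd_mul (c := Real.exp (-a)) hψ.integrableOn
    (by fun_prop : Continuous fun s : ℝ => (Real.exp (-s) : ℂ)).aestronglyMeasurable ?_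
  filter_upwards [ae_restrict_mem measurableSet_Ioi] with s hs
  rw [Complex.norm_real, Real.norm_eq_abs, Real.abs_exp]
  exact Real.exp_le_exp.2 (neg_le_neg (le_of_lt hs))

theorem hasDerivAt_expResolvent {ψ : ℝ → ℂ} (hc : Continuous ψ) (hψ : Integrable ψ) (y : ℝ) :
    HasDerivAt (expResolvent ψ) (expResolvent ψ y - ψ y) y := by
  set g : ℝ → ℂ := fun s => (Real.exp (-s) : ℂ) * ψ s with hg
  have hgc : Continuous g := by fun_prop
  have h1 : expResolvent ψ = fun y =>
      (Real.exp y : ℂ) * ((∫ s in Set.Ioi 0, g s) - ∫ s in (0 : ℝ)..y, g s) := by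
    ext y
    rw [expResolvent_eq_setIntegral, ← intervalIntegral.integral_interval_add_Ioi'
      (hgc.intervalIntegrable 0 y) (integrableOn_exp_neg_mul hψ y)]
    ring
  have h2 : HasDerivAt (fun y => ∫ s in (0 : ℝ)..y, g s) (g y) y :=
    hgc.integral_hasStrictDerivAt 0 y |>.hasDerivAt
  have h3 : HasDerivAt (fun y : ℝ => (Real.exp y : ℂ)) (Real.exp y : ℂ) y :=
    (Real.hasDerivAt_exp y).ofReal_comp
  have h4 := h3.mul (h2.const_sub (∫ s in Set.Ioi 0, g s))
  rw [h1]
  convert! h4 using 1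
  have : (Real.exp y : ℂ) * (Real.exp (-y) : ℂ) = 1 := by
    rw [← Complex.ofReal_mul, ← Real.exp_add]; simp
  simp only [hg]
  linear_combination ψ y * this

/-- This joint integrability licenses Fubini, both for the `L¹` bound on the resolvent and for its
form as an `L¹`-valued integral. -/
theorem integrable_expKernel_sub_mul {ψ : ℝ → ℂ} (hψ : Integrable ψ) :
    Integrable (fun p : ℝ × ℝ => expKernel (p.2 - p.1) * ψ p.2) (volume.prod volume) := by
  have := hψ.convolution_integrand (ContinuousLinearMap.mul ℂ ℂ) integrable_expKernel.comp_neg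
  simpa [mul_comm] using this

theorem integrable_expResolvent {ψ : ℝ → ℂ} (hψ : Integrable ψ) :
    Integrable (expResolvent ψ) :=
  (integrable_expKernel_sub_mul hψ).integral_prod_left

theorem integral_norm_expResolvent_le {ψ : ℝ → ℂ} (hψ : Integrable ψ) :
    ∫ y, ‖expResolvent ψ y‖ ≤ ∫ x, ‖ψ x‖ := by
  have h := (integrable_expKernel_sub_mul hψ).norm
  calc ∫ y, ‖expResolvent ψ y‖ ≤ ∫ y, ∫ x, ‖expKernel (x - y) * ψ x‖ :=
        integral_mono (integrable_expResolvent hψ).norm h.integral_prod_left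
          fun y => norm_integral_le_integral_norm _
    _ = ∫ x, ∫ y, ‖expKernel (x - y) * ψ x‖ := integral_integral_swap h
    _ = ∫ x, ‖ψ x‖ := by
        congr 1
        ext x
        simp only [norm_mul, integral_mul_const]
        rw [integral_sub_left_eq_self (fun t => ‖expKernel t‖) volume x, integral_norm_expKernel,
          one_mul]

/-- The integrand `e^{-s} (ψ - ψ')` is the derivative of `-e^{-s} ψ`. The boundary term at infinity
vanishes because that function and its derivative are both integrable on the half-line. -/
theorem expResolvent_sub_deriv {ψ : ℝ → ℂ} (hd : Differentiable ℝ ψ) (hψ : Integrable ψ)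
    (hψ' : Integrable (deriv ψ)) : expResolvent (ψ - deriv ψ) = ψ := by
  ext y
  rw [expResolvent_eq_setIntegral]
  have hder : ∀ x : ℝ, HasDerivAt (fun s => -((Real.exp (-s) : ℂ) * ψ s))
      ((Real.exp (-x) : ℂ) * (ψ - deriv ψ) x) x := fun x => by
    have h3 : HasDerivAt (fun y : ℝ => (Real.exp (-y) : ℂ)) (Real.exp (-x) * (-1) : ℝ) x :=
      ((hasDerivAt_neg x).exp).ofReal_comp
    convert! (h3.mul (hd x).hasDerivAt).neg using 1
    simp only [Pi.sub_apply]
    push_cast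
    ring
  have hint := integrableOn_exp_neg_mul (hψ.sub hψ') y
  rw [integral_Ioi_of_hasDerivAt_of_tendsto' (fun x _ => hder x) hint
    (tendsto_zero_of_hasDerivAt_of_integrableOn_Ioi (fun x _ => hder x) hint
      (integrableOn_exp_neg_mul hψ y).neg), zero_sub, neg_neg, ← mul_assoc, ← Complex.ofReal_mul,
      ← Real.exp_add]
  simp

/-! ### The resolvent as a continuous operator on `D_{L¹}` -/

namespace DL1

theorem differentiable (φ : DL1) : Differentiable ℝ φ :=
  φ.contDiff.differentiable (by simp)

theorem integrable_self (φ : DL1) : Integrable φ := by simpa using φ.integrable 0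

theorem contDiff_natCast (φ : DL1) (n : ℕ) : ContDiff ℝ n φ :=
  φ.contDiff.of_le (by exact_mod_cast le_top)

theorem deriv_expResolvent (φ : DL1) : deriv (expResolvent φ) = expResolvent φ - φ := by
  ext y
  exact (hasDerivAt_expResolvent φ.contDiff.continuous φ.integrable_self y).deriv

theorem contDiff_expResolvent (φ : DL1) : ContDiff ℝ ∞ (expResolvent φ) := by
  have hd : Differentiable ℝ (expResolvent φ) := fun y =>
    (hasDerivAt_expResolvent φ.contDiff.continuous φ.integrable_self y).differentiableAt
  rw [contDiff_infty]
  intro n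
  induction n with
  | zero => exact contDiff_zero.2 hd.continuous
  | succ n ih =>
    push_cast
    rw [contDiff_succ_iff_deriv]
    refine ⟨hd, by simp, ?_⟩
    rw [deriv_expResolvent]
    exact ih.sub (φ.contDiff_natCast n)

theorem iteratedDeriv_succ_expResolvent (φ : DL1) (i : ℕ) :
    iteratedDeriv (i + 1) (expResolvent φ) =
      iteratedDeriv i (expResolvent φ) - iteratedDeriv i φ := by
  ext x
  rw [iteratedDeriv_succ', deriv_expResolvent]
  exact iteratedDeriv_sub (φ.contDiff_expResolvent.contDiffAt.of_le (by exact_mod_cast le_top))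
    (φ.contDiff_natCast i).contDiffAt

/-- The operator `(1 - d/dx)⁻¹` on `D_{L¹}`. -/
def resolventLM : DL1 →ₗ[ℂ] DL1 where
  toFun φ := ⟨expResolvent φ, φ.contDiff_expResolvent, fun i => by
    induction i with
    | zero => simpa using integrable_expResolvent φ.integrable_self
    | succ i ih =>
      rw [iteratedDeriv_succ_expResolvent]
      exact ih.sub (φ.integrable i)⟩
  map_add' φ ψ := Subtype.ext <| funext fun x => by
    change expResolvent (φ + ψ : DL1) x = expResolvent φ x + expResolvent ψ x
    simp only [expResolvent_eq_setIntegral, coe_add, Pi.add_apply, mul_add]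
    rw [integral_add (integrableOn_exp_neg_mul φ.integrable_self x)
      (integrableOn_exp_neg_mul ψ.integrable_self x), mul_add]
  map_smul' c φ := Subtype.ext <| funext fun x => by
    change expResolvent (c • φ : DL1) x = c * expResolvent φ x
    simp only [expResolvent, coe_smul, Pi.smul_apply, smul_eq_mul, mul_left_comm _ c,
      integral_const_mul]

theorem norm_mono (φ : DL1) {m n : ℕ} (h : m ≤ n) : norm m φ ≤ norm n φ := by
  rw [norm_apply, norm_apply]
  exact Finset.sum_le_sum_of_subset_of_nonneg (Finset.range_mono (by omega))
    fun i _ _ => integral_nonneg fun x => norm_nonneg _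

/-- For `u = Rφ`, iterating `u^{(i+1)} = u^{(i)} - φ^{(i)}` bounds `‖u^{(i)}‖` by `‖φ‖` plus the
norms of `φ^{(j)}`, `j < i`. Even `i = m + 1` thus needs only `m` derivatives of `φ`. Each of the `m
+ 2` terms is at most `2 |φ|_{m,1}`. -/
theorem norm_succ_resolventLM_le (m : ℕ) (φ : DL1) :
    norm (m + 1) (resolventLM φ) ≤ 2 * (m + 2) * norm m φ := by
  have key : ∀ i, ∫ x, ‖iteratedDeriv i (resolventLM φ) x‖ ≤
      (∫ x, ‖φ x‖) + ∑ j ∈ Finset.range i, ∫ x, ‖iteratedDeriv j φ x‖ := by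
    intro i
    induction i with
    | zero =>
      simp only [iteratedDeriv_zero, Finset.range_zero, Finset.sum_empty, add_zero]
      exact integral_norm_expResolvent_le φ.integrable_self
    | succ i ih =>
      have h : ∫ x, ‖iteratedDeriv (i + 1) (resolventLM φ) x‖ ≤
          (∫ x, ‖iteratedDeriv i (resolventLM φ) x‖) + ∫ x, ‖iteratedDeriv i φ x‖ := by
        rw [← integral_add ((resolventLM φ).integrable i).norm (φ.integrable i).norm]
        refine integral_mono ((resolventLM φ).integrable (i + 1)).norm
          (((resolventLM φ).integrable i).norm.add (φ.integrable i).norm) fun x => ?_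
        change ‖iteratedDeriv (i + 1) (expResolvent φ) x‖ ≤ _
        rw [iteratedDeriv_succ_expResolvent]
        exact norm_sub_le _ _
      rw [Finset.sum_range_succ]
      linarith
  have h2 : ∀ i ∈ Finset.range (m + 1 + 1), ∫ x, ‖iteratedDeriv i (resolventLM φ) x‖ ≤
      2 * norm m φ := by
    intro i hi
    have h0 : ∫ x, ‖φ x‖ ≤ norm m φ := by simpa using φ.integral_le_norm (Nat.zero_le m)
    have h1 : ∑ j ∈ Finset.range i, ∫ x, ‖iteratedDeriv j φ x‖ ≤ norm m φ := by
      rw [norm_apply]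
      exact Finset.sum_le_sum_of_subset_of_nonneg
        (Finset.range_mono (by have := Finset.mem_range.1 hi; omega))
        fun i _ _ => integral_nonneg fun x => norm_nonneg _
    linarith [key i]
  rw [norm_apply]
  refine (Finset.sum_le_sum h2).trans (le_of_eq ?_)
  simp only [Finset.sum_const, Finset.card_range, nsmul_eq_mul]
  push_cast
  ring

/-- The operator `(1 - d/dx)⁻¹` as a continuous linear operator on `D_{L¹}`. -/
def resolvent : DL1 →L[ℂ] DL1 where
  toLinearMap := resolventLM
  cont := by
    refine WithSeminorms.continuous_of_isBounded withSeminorms withSeminorms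
      resolventLM fun m => ⟨{m}, (2 * (m + 2) : NNReal), fun φ => ?_⟩
    simp only [Finset.sup_singleton]
    exact (norm_mono _ (Nat.le_succ m)).trans (norm_succ_resolventLM_le m φ)

@[simp] theorem coe_resolvent (φ : DL1) : (resolvent φ : ℝ → ℂ) = expResolvent φ := rfl

theorem norm_succ_resolvent_le (m : ℕ) (φ : DL1) :
    norm (m + 1) (resolvent φ) ≤ 2 * (m + 2) * norm m φ := norm_succ_resolventLM_le m φ

theorem ext {φ ψ : DL1} (h : ∀ x, φ x = ψ x) : φ = ψ := Subtype.ext (funext h)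

theorem resolvent_sub_derivCLM (φ : DL1) : resolvent (φ - derivCLM φ) = φ := by
  refine DL1.ext fun x => ?_
  have h : (φ - derivCLM φ : DL1) = (φ : ℝ → ℂ) - deriv φ := rfl
  rw [coe_resolvent, h, expResolvent_sub_deriv φ.differentiable φ.integrable_self]
  simpa using φ.integrable 1

end DL1

/-! ### Reflected translates, finite order and density of test functions -/

namespace DL1

theorem iteratedDeriv_comp_sub_left (φ : DL1) (x : ℝ) (i : ℕ) :
    iteratedDeriv i (fun y => φ (x - y)) =
      fun y => (-1 : ℝ) ^ i • iteratedDeriv i φ (x - y) :=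
  iteratedDeriv_comp_const_sub i φ x

/-- The function `y ↦ φ (x - y)`. -/
def subLeft (x : ℝ) (φ : DL1) : DL1 :=
  ⟨fun y => φ (x - y), φ.contDiff.comp (contDiff_const.sub contDiff_id), fun i => by
    rw [iteratedDeriv_comp_sub_left]
    exact ((φ.integrable i).comp_sub_left x).smul ((-1 : ℝ) ^ i)⟩

@[simp] theorem subLeft_apply (x : ℝ) (φ : DL1) (y : ℝ) : subLeft x φ y = φ (x - y) := rfl

theorem subLeft_sub (x : ℝ) (φ ψ : DL1) : subLeft x (φ - ψ) = subLeft x φ - subLeft x ψ := rfl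

@[simp] theorem norm_subLeft (m : ℕ) (x : ℝ) (φ : DL1) : norm m (subLeft x φ) = norm m φ := by
  rw [norm_apply, norm_apply]
  refine Finset.sum_congr rfl fun i _ => ?_
  change ∫ y, ‖iteratedDeriv i (fun y => φ (x - y)) y‖ = _
  rw [iteratedDeriv_comp_sub_left]
  simp only [norm_smul, norm_pow, norm_neg, norm_one, one_pow, one_mul]
  exact integral_sub_left_eq_self (fun t => ‖iteratedDeriv i φ t‖) volume x

/-- The resolvent commutes with translations but not with reflections, so it gets conjugated by the
reflection `subLeft 0`. The right side is `subLeft x` of a function independent of `x`. -/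
theorem resolvent_subLeft (x : ℝ) (φ : DL1) :
    resolvent (subLeft x φ) = subLeft x (subLeft 0 (resolvent (subLeft 0 φ))) := by
  refine DL1.ext fun y => ?_
  simp only [subLeft_apply, coe_resolvent, expResolvent_eq_integral_add]
  refine integral_congr_ae (Eventually.of_forall fun t => ?_)
  change expKernel t * φ (x - (y + t)) = expKernel t * φ (0 - (0 - (x - y) + t))
  rw [show 0 - (0 - (x - y) + t) = x - (y + t) by ring]

/-- The norms increase with `m`, so the finitely many that control `T` are dominated by the one of
largest index. -/
theorem exists_norm_apply_le (T : BoundedDistribution) :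
    ∃ (m : ℕ) (C : ℝ), 0 ≤ C ∧ ∀ ψ : DL1, ‖T ψ‖ ≤ C * norm m ψ := by
  obtain ⟨s, C, -, h⟩ := Seminorm.bound_of_continuous withSeminorms
    ((normSeminorm ℂ ℂ).comp T.toLinearMap) (continuous_norm.comp T.continuous)
  refine ⟨s.sup id, C, C.2, fun ψ => (h ψ).trans ?_⟩
  rw [smul_apply, NNReal.smul_def, smul_eq_mul]
  refine mul_le_mul_of_nonneg_left ?_ C.2
  have h2 : s.sup norm ≤ norm (s.sup id) :=
    Finset.sup_le fun i hi φ => norm_mono φ (Finset.le_sup (f := id) hi)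
  exact h2 ψ

/-- The test functions are dense in `D_{L¹}`. -/
theorem exists_testFunction_norm_sub_lt (φ : DL1) (m : ℕ) {ε : ℝ} (hε : 0 < ε) :
    ∃ η : 𝓓((⊤ : TopologicalSpace.Opens ℝ), ℂ), norm m (φ - ofTestFunction η) < ε := by
  let b : ContDiffBump (0 : ℝ) := ⟨1, 2, one_pos, one_lt_two⟩
  let θ : ℝ → ℂ := fun x => (b x : ℂ)
  have hθ : ContDiff ℝ ∞ θ := Complex.ofRealCLM.contDiff.comp b.contDiff
  have hθs : HasCompactSupport θ := b.hasCompactSupport.comp_left Complex.ofReal_zero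
  -- The cut-offs `θ(c n * x)` equal `1` for `|x| ≤ n + 1`. Since `c n ≤ 1`, the chain-rule factors
  -- `(c n)^j` keep their derivatives bounded uniformly in `n`.
  let c : ℕ → ℝ := fun n => 1 / ((n : ℝ) + 1)
  have hc0 : ∀ n, 0 < c n := fun n => Nat.one_div_pos_of_nat
  have hc1 : ∀ n, c n ≤ 1 := fun n => by
    simp only [c]
    rw [div_le_one (by positivity)]
    linarith [Nat.cast_nonneg (α := ℝ) n]
  have hθn : ∀ n, ContDiff ℝ ∞ fun x => θ (c n * x) := fun n =>
    hθ.comp (contDiff_const.mul contDiff_id)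
  let η : ℕ → 𝓓((⊤ : TopologicalSpace.Opens ℝ), ℂ) := fun n =>
    { toFun := fun x => θ (c n * x) * φ x
      contDiff' := (hθn n).mul φ.contDiff
      hasCompactSupport' := (hθs.comp_homeomorph (Homeomorph.mulLeft₀ (c n) (hc0 n).ne')).mul_right
      tsupport_subset' := fun _ _ => trivial }
  have hM : ∀ j, ∃ M, ∀ x, ‖iteratedDeriv j θ x‖ ≤ M := fun j => by
    refine HasCompactSupport.exists_bound_of_continuous ?_
      (hθ.continuous_iteratedDeriv j (by exact_mod_cast le_top))
    induction j with
    | zero => simpa using hθs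
    | succ j ih => rw [iteratedDeriv_succ]; exact ih.deriv
  choose M hM using hM
  have hbound : ∀ i n x, ‖iteratedDeriv i (φ - ofTestFunction (η n) : DL1) x‖ ≤
      ‖iteratedDeriv i φ x‖ + ∑ j ∈ Finset.range (i + 1),
        (i.choose j : ℝ) * M j * ‖iteratedDeriv (i - j) φ x‖ := by
    intro i n x
    have h1 : iteratedDeriv i (φ - ofTestFunction (η n) : DL1) x =
        iteratedDeriv i φ x - iteratedDeriv i (fun x => θ (c n * x) * φ x) x :=
      iteratedDeriv_sub (φ.contDiff_natCast i).contDiffAt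
        ((ofTestFunction (η n)).contDiff_natCast i).contDiffAt
    rw [h1]
    refine (norm_sub_le _ _).trans (add_le_add_right ?_ _)
    have h2 := norm_iteratedFDeriv_mul_le (hθn n) φ.contDiff x (n := i)
      (by exact_mod_cast le_top)
    simp only [norm_iteratedFDeriv_eq_norm_iteratedDeriv] at h2
    refine h2.trans (Finset.sum_le_sum fun j _ => ?_)
    refine mul_le_mul_of_nonneg_right (mul_le_mul_of_nonneg_left ?_ (by positivity)) (norm_nonneg _)
    rw [iteratedDeriv_comp_const_smul (hθ.of_le (by exact_mod_cast le_top)) (c n), norm_smul,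
      norm_pow, Real.norm_of_nonneg (hc0 n).le]
    exact (mul_le_of_le_one_left (norm_nonneg _) (pow_le_one₀ (hc0 n).le (hc1 n))).trans (hM j _)
  have hlim : ∀ i x, Tendsto
      (fun n => ‖iteratedDeriv i (φ - ofTestFunction (η n) : DL1) x‖) atTop (𝓝 0) := by
    intro i x
    refine tendsto_const_nhds.congr' ?_
    filter_upwards [eventually_ge_atTop ⌈|x|⌉₊] with n hn
    have hn : |x| < (n : ℝ) + 1 := ((Nat.le_ceil _).trans (Nat.cast_le.2 hn)).trans_lt
      (lt_add_one _)
    -- Near `x` the cut-off is identically `1`, so the difference and all its derivatives vanish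
    -- there.
    have hev : ((φ - ofTestFunction (η n) : DL1) : ℝ → ℂ) =ᶠ[𝓝 x] fun _ => 0 := by
      filter_upwards [continuous_abs.continuousAt.eventually (gt_mem_nhds hn)] with y hy
      change φ y - θ (c n * y) * φ y = 0
      have : b (c n * y) = 1 := by
        refine b.one_of_mem_closedBall ?_
        rw [mem_closedBall_zero_iff, Real.norm_eq_abs, abs_mul, abs_of_pos (hc0 n)]
        change 1 / ((n : ℝ) + 1) * |y| ≤ 1
        rw [one_div_mul_eq_div, div_le_one (by positivity)]
        exact hy.le
      simp only [θ, this, Complex.ofReal_one, one_mul, sub_self]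
    rw [hev.iteratedDeriv_eq i, iteratedDeriv_fun_const_zero, norm_zero]
  have hT : Tendsto (fun n => norm m (φ - ofTestFunction (η n))) atTop (𝓝 0) := by
    simp only [norm_apply]
    rw [← Finset.sum_const_zero (s := Finset.range (m + 1)) (M := ℝ)]
    refine tendsto_finsetSum _ fun i _ => ?_
    rw [← integral_zero ℝ ℝ]
    refine tendsto_integral_of_dominated_convergence
      (fun x => ‖iteratedDeriv i φ x‖ + ∑ j ∈ Finset.range (i + 1),
        (i.choose j : ℝ) * M j * ‖iteratedDeriv (i - j) φ x‖)
      (fun n => ((φ - ofTestFunction (η n)).integrable i).norm.aestronglyMeasurable)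
      ((φ.integrable i).norm.add (integrable_finsetSum _ fun j _ =>
        (φ.integrable (i - j)).norm.const_mul _)) (fun n => ?_) ?_
    · exact Eventually.of_forall fun x => by
        rw [norm_norm]
        simpa using hbound i n x
    · exact Eventually.of_forall (hlim i)
  obtain ⟨n, hn⟩ := (hT.eventually (gt_mem_nhds hε)).exists
  exact ⟨η n, hn⟩

end DL1

/-! ### Closure properties of almost automorphic functions -/

/-- Diagonal extraction: if each property of sequences of indices in a countable family can be
achieved by extraction and is inherited by sequences that are eventually extracted, then all
of them can be achieved at once. -/
theorem exists_strictMono_forall_of_extraction (P : ℕ → (ℕ → ℕ) → Prop)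
    (hex : ∀ j (u : ℕ → ℕ), ∃ v : ℕ → ℕ, StrictMono v ∧ P j (u ∘ v))
    (hP : ∀ j (u v w : ℕ → ℕ), P j u → Tendsto v atTop atTop → w =ᶠ[atTop] u ∘ v → P j w) :
    ∃ u : ℕ → ℕ, StrictMono u ∧ ∀ j, P j u := by
  choose v hv hPv using hex
  let U : ℕ → ℕ → ℕ := fun j => Nat.rec (v 0 id) (fun j w => w ∘ v (j + 1) w) j
  have hUs : ∀ j, U (j + 1) = U j ∘ v (j + 1) (U j) := fun j => rfl
  have hU : ∀ j, StrictMono (U j) := fun j => by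
    induction j with
    | zero => exact hv 0 id
    | succ j ih => rw [hUs]; exact ih.comp (hv _ _)
  have hPU : ∀ j, P j (U j) := fun j => by
    cases j with
    | zero => exact hPv 0 id
    | succ j => exact hPv (j + 1) (U j)
  have hle : ∀ j i, ∃ w : ℕ → ℕ, StrictMono w ∧ U (j + i) = U j ∘ w := fun j i => by
    induction i with
    | zero => exact ⟨id, strictMono_id, rfl⟩
    | succ i ih =>
      obtain ⟨w, hw, h⟩ := ih
      exact ⟨w ∘ v (j + i + 1) (U (j + i)), hw.comp (hv _ _), by
        rw [← add_assoc, hUs, h, Function.comp_assoc]⟩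
  choose w hw hUw using hle
  refine ⟨fun k => U k k, strictMono_nat_of_lt_succ fun k => ?_, fun j => ?_⟩
  · rw [hUs]
    exact hU k ((Nat.lt_succ_self k).trans_le ((hv (k + 1) (U k)).id_le _))
  -- From `k = j` on, the diagonal reindexes `U j` by `w j (k - j) k ≥ k`. The hypothesis `hP` asks
  -- only that this index tend to infinity.
  · refine hP j (U j) (fun k => w j (k - j) k) _ (hPU j)
      (tendsto_atTop_mono (fun k => (hw j (k - j)).id_le k) tendsto_id) ?_
    filter_upwards [eventually_ge_atTop j] with k hk
    have := hUw j (k - j)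
    rw [Nat.add_sub_cancel' hk] at this
    rw [this]
    rfl

namespace AlmostAutomorphic

variable {f h : ℝ → ℂ}

theorem congr (hf : AlmostAutomorphic f) (e : ∀ x, f x = h x) : AlmostAutomorphic h :=
  funext e ▸ hf

theorem zero : AlmostAutomorphic 0 :=
  ⟨continuous_const, fun _ => ⟨id, strictMono_id, 0, fun _ => tendsto_const_nhds,
    fun _ => tendsto_const_nhds⟩⟩

theorem add (hf : AlmostAutomorphic f) (hh : AlmostAutomorphic h) :
    AlmostAutomorphic (f + h) := by
  refine ⟨hf.1.add hh.1, fun s => ?_⟩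
  obtain ⟨n, hn, g, hg, hg'⟩ := hf.2 s
  obtain ⟨p, hp, k, hk, hk'⟩ := hh.2 (s ∘ n)
  exact ⟨n ∘ p, hn.comp hp, g + k,
    fun x => ((hg x).comp hp.tendsto_atTop).add (hk x),
    fun x => ((hg' x).comp hp.tendsto_atTop).add (hk' x)⟩

theorem const_mul (hf : AlmostAutomorphic f) (c : ℂ) : AlmostAutomorphic fun x => c * f x := by
  refine ⟨continuous_const.mul hf.1, fun s => ?_⟩
  obtain ⟨n, hn, g, hg, hg'⟩ := hf.2 s
  exact ⟨n, hn, fun x => c * g x, fun x => (hg x).const_mul c, fun x => (hg' x).const_mul c⟩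

theorem sum {ι : Type*} (s : Finset ι) {f : ι → ℝ → ℂ} (hf : ∀ i, AlmostAutomorphic (f i)) :
    AlmostAutomorphic (∑ i ∈ s, f i) := by
  classical
  induction s using Finset.induction_on with
  | empty => exact zero
  | insert i s hi ih => rw [Finset.sum_insert hi]; exact (hf i).add ih

/-- A uniform limit of almost automorphic functions is almost automorphic. -/
theorem of_forall_exists_norm_sub_le
    (H : ∀ ε > 0, ∃ h, AlmostAutomorphic h ∧ ∀ x, ‖f x - h x‖ ≤ ε) : AlmostAutomorphic f := by
  choose! F hF hFf using H
  let ε : ℕ → ℝ := fun n => 1 / ((n : ℝ) + 1)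
  have hε : ∀ n, 0 < ε n := fun n => Nat.one_div_pos_of_nat
  have hεlim : Tendsto ε atTop (𝓝 0) := tendsto_one_div_add_atTop_nhds_zero_nat
  have hunif : TendstoUniformly (fun n => F (ε n)) f atTop := by
    rw [Metric.tendstoUniformly_iff]
    intro δ hδ
    filter_upwards [hεlim.eventually (gt_mem_nhds hδ)] with n hn x
    rw [dist_eq_norm]
    exact (hFf _ (hε n) x).trans_lt hn
  refine ⟨hunif.continuous (Frequently.of_forall fun n => (hF _ (hε n)).1), fun s => ?_⟩
  -- One subsequence serves all the approximants `F (ε j)` simultaneously.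
  obtain ⟨u, hu, hPu⟩ := exists_strictMono_forall_of_extraction
    (fun j u => ∃ g : ℝ → ℂ, (∀ x, Tendsto (fun k => F (ε j) (x + s (u k))) atTop (𝓝 (g x))) ∧
      (∀ x, Tendsto (fun k => g (x - s (u k))) atTop (𝓝 (F (ε j) x))))
    (fun j u => (hF _ (hε j)).2 (s ∘ u))
    (fun j u v w ⟨g, hg, hg'⟩ hv hw => ⟨g,
      fun x => ((hg x).comp hv).congr' (hw.mono fun k hk => by simp [hk]),
      fun x => ((hg' x).comp hv).congr' (hw.mono fun k hk => by simp [hk])⟩)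
  choose G hG hG' using hPu
  have hex : ∀ x, ∃ y, Tendsto (fun k => f (x + s (u k))) atTop (𝓝 y) := fun x => by
    refine cauchySeq_tendsto_of_complete (Metric.cauchySeq_iff'.2 fun δ hδ => ?_)
    obtain ⟨j, hj⟩ := (hεlim.eventually (gt_mem_nhds (show 0 < δ / 3 by positivity))).exists
    obtain ⟨N, hN⟩ := Metric.cauchySeq_iff'.1 (hG j x).cauchySeq (δ / 3) (by positivity)
    refine ⟨N, fun n hn => ?_⟩
    have h1 := hFf _ (hε j) (x + s (u n))
    have h2 := hFf _ (hε j) (x + s (u N))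
    have h3 := hN n hn
    rw [← dist_eq_norm] at h1 h2
    rw [dist_comm] at h2
    have := dist_triangle4 (f (x + s (u n))) (F (ε j) (x + s (u n))) (F (ε j) (x + s (u N)))
      (f (x + s (u N)))
    linarith
  choose g hg using hex
  -- The closeness of `f` to `F (ε j)` passes to the limits uniformly in `x`, which is what the
  -- return limit needs at the moving points `x - s (u k)`.
  have hgG : ∀ j x, ‖g x - G j x‖ ≤ ε j := fun j x =>
    le_of_tendsto ((hg x).sub (hG j x)).norm (Eventually.of_forall fun k => hFf _ (hε j) _)
  refine ⟨u, hu, g, hg, fun x => ?_⟩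
  rw [Metric.tendsto_nhds]
  intro δ hδ
  obtain ⟨j, hj⟩ := (hεlim.eventually (gt_mem_nhds (show 0 < δ / 3 by positivity))).exists
  filter_upwards [Metric.tendsto_nhds.1 (hG' j x) (δ / 3) (by positivity)] with k hk
  have h1 := hgG j (x - s (u k))
  have h2 := hFf _ (hε j) x
  rw [← dist_eq_norm] at h1 h2
  rw [dist_comm] at h2
  have := dist_triangle4 (g (x - s (u k))) (G j (x - s (u k))) (F (ε j) x) (f x)
  linarith

/-- The convolution of an almost automorphic function with an integrable function is almost
automorphic. -/
theorem convolution (hf : AlmostAutomorphic f) {φ : ℝ → ℂ} (hφ : Integrable φ) :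
    AlmostAutomorphic fun x => ∫ y, f (x - y) * φ y := by
  obtain ⟨C, hC⟩ := hf.bounded
  have hlim : ∀ {u : ℕ → ℝ → ℂ} {v : ℝ → ℂ}, (∀ k, StronglyMeasurable (u k)) →
      (∀ k x, ‖u k x‖ ≤ C) → (∀ x, Tendsto (fun k => u k x) atTop (𝓝 (v x))) →
      Tendsto (fun k => ∫ y, u k y * φ y) atTop (𝓝 (∫ y, v y * φ y)) :=
    fun {u v} hu hb huv => tendsto_integral_of_dominated_convergence (fun y => C * ‖φ y‖)
      (fun k => (hu k).aestronglyMeasurable.mul hφ.aestronglyMeasurable) (hφ.norm.const_mul C)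
      (fun k => Eventually.of_forall fun y => by
        rw [norm_mul]
        exact mul_le_mul_of_nonneg_right (hb k y) (norm_nonneg _))
      (Eventually.of_forall fun y => (huv y).mul_const (φ y))
  have hfm : StronglyMeasurable f := hf.1.stronglyMeasurable
  refine ⟨?_, fun s => ?_⟩
  · refine continuous_of_dominated (bound := fun y => C * ‖φ y‖)
      (fun x => (hfm.comp_measurable (measurable_const.sub measurable_id)).aestronglyMeasurable.mul
        hφ.aestronglyMeasurable)
      (fun x => Eventually.of_forall fun y => ?_) (hφ.norm.const_mul C)
      (Eventually.of_forall fun y => (hf.1.comp (continuous_id.sub continuous_const)).mul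
        continuous_const)
    rw [norm_mul]
    exact mul_le_mul_of_nonneg_right (hC _) (norm_nonneg _)
  · obtain ⟨n, hn, g, hg, hg'⟩ := hf.2 s
    -- The limit `g` need not be continuous; measurability and the bound `C` suffice for dominated
    -- convergence.
    have hgm : StronglyMeasurable g := stronglyMeasurable_of_tendsto atTop
      (fun k => hfm.comp_measurable (measurable_id.add_const (s (n k)))) (tendsto_pi_nhds.2 hg)
    have hgC : ∀ x, ‖g x‖ ≤ C := fun x =>
      le_of_tendsto (hg x).norm (Eventually.of_forall fun k => hC _)
    refine ⟨n, hn, fun x => ∫ y, g (x - y) * φ y, fun x => ?_, fun x => ?_⟩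
    · exact hlim (fun k => hfm.comp_measurable (measurable_const.sub measurable_id))
        (fun k y => hC _) fun y => by simpa [add_sub_right_comm] using hg (x - y)
    · exact hlim (fun k => hgm.comp_measurable (measurable_const.sub measurable_id))
        (fun k y => hgC _) fun y => by simpa [sub_right_comm] using hg' (x - y)

end AlmostAutomorphic

/-! ### Embedding in `L¹` and the resolvent as a Bochner integral -/

theorem exists_testFunction_integral_norm_sub_le {h : ℝ → ℂ} (hh : Integrable h) {ε : ℝ}
    (hε : 0 < ε) :
    ∃ η : 𝓓((⊤ : TopologicalSpace.Opens ℝ), ℂ), ∫ x, ‖h x - η x‖ ≤ ε := by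
  obtain ⟨g, hg, hg', hle⟩ := MemLp.exist_eLpNorm_sub_le ENNReal.one_ne_top le_rfl
    (memLp_one_iff_integrable.2 hh) hε
  refine ⟨⟨g, hg', hg, fun _ _ => trivial⟩, ?_⟩
  have hint : Integrable (h - g) :=
    hh.sub (hg'.continuous.integrable_of_hasCompactSupport hg)
  change ∫ x, ‖(h - g) x‖ ≤ ε
  rw [eLpNorm_one_eq_lintegral_enorm] at hle
  rw [integral_norm_eq_lintegral_enorm hint.aestronglyMeasurable]
  exact ENNReal.toReal_le_of_le_ofReal hε.le hle

namespace DL1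

/-- The inclusion of `D_{L¹}` into `L¹`. -/
def toL1 : DL1 →ₗ[ℂ] (ℝ →₁[volume] ℂ) where
  toFun φ := φ.integrable_self.toL1 φ
  map_add' φ ψ := Integrable.toL1_add _ _ φ.integrable_self ψ.integrable_self
  map_smul' c φ := Integrable.toL1_smul' _ φ.integrable_self c

theorem norm_toL1 (φ : DL1) : ‖toL1 φ‖ = norm 0 φ := by
  change ‖φ.integrable_self.toL1 φ‖ = _
  rw [L1.norm_of_fun_eq_integral_norm]
  simp [norm_apply]

theorem denseRange_toL1 : DenseRange toL1 := by
  intro F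
  refine Metric.mem_closure_iff.2 fun ε hε => ?_
  obtain ⟨η, hη⟩ := exists_testFunction_integral_norm_sub_le (L1.integrable_coeFn F) (half_pos hε)
  refine ⟨_, ⟨ofTestFunction η, rfl⟩, lt_of_le_of_lt ?_ (half_lt_self hε)⟩
  rw [dist_eq_norm, ← Integrable.toL1_coeFn F (L1.integrable_coeFn F)]
  change ‖_ - Integrable.toL1 _ (ofTestFunction η).integrable_self‖ ≤ _
  rw [← Integrable.toL1_sub, L1.norm_of_fun_eq_integral_norm]
  exact hη

end DL1

/-- The translates of the reflected kernel `y ↦ expKernel (x - y)`, as elements of `L¹`. -/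
def expKernelTranslate (x : ℝ) : ℝ →₁[volume] ℂ :=
  (integrable_expKernel.comp_sub_left x).toL1 fun y => expKernel (x - y)

theorem norm_expKernelTranslate (x : ℝ) : ‖expKernelTranslate x‖ = 1 := by
  rw [expKernelTranslate, L1.norm_of_fun_eq_integral_norm,
    integral_sub_left_eq_self (fun t => ‖expKernel t‖) volume x, integral_norm_expKernel]

/-- The kernel jumps at `0`, but translation acts continuously on `L¹`. This provides the
measurability of the Bochner integrand below. -/
theorem continuous_expKernelTranslate : Continuous expKernelTranslate := by
  have h : expKernelTranslate = fun x => DomAddAct.mk (-x : ℝ) +ᵥ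
      (memLp_one_iff_integrable.2 integrable_expKernel.comp_neg).toLp := by
    ext1 x
    rw [DomAddAct.mk_vadd_toLp]
    refine (MemLp.toLp_eq_toLp_iff
      (memLp_one_iff_integrable.2 (integrable_expKernel.comp_sub_left x)) _).2 (Eventually.of_forall fun y => ?_)
    simp [sub_eq_add_neg, add_comm]
  have : Fact ((1 : ENNReal) ≠ ⊤) := ⟨ENNReal.one_ne_top⟩
  rw [h]
  exact ((DomAddAct.continuous_mk).comp continuous_neg).vadd continuous_const

theorem integrable_smul_expKernelTranslate {ψ : ℝ → ℂ} (hψ : Integrable ψ) :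
    Integrable fun x => ψ x • expKernelTranslate x := by
  refine (hψ.norm).mono'
    (hψ.aestronglyMeasurable.smul continuous_expKernelTranslate.aestronglyMeasurable)
    (Eventually.of_forall fun x => ?_)
  rw [norm_smul, norm_expKernelTranslate, mul_one]

/-- Integration over a set as a continuous linear form on `L¹`. -/
def setIntegralL1 (s : Set ℝ) : (ℝ →₁[volume] ℂ) →L[ℂ] ℂ where
  toFun F := ∫ x in s, F x
  map_add' F G := by
    rw [← integral_add (L1.integrable_coeFn F).integrableOn (L1.integrable_coeFn G).integrableOn]
    exact integral_congr_ae (ae_restrict_of_ae (Lp.coeFn_add F G))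
  map_smul' c F := by
    rw [RingHom.id_apply, ← integral_smul]
    exact integral_congr_ae (ae_restrict_of_ae (Lp.coeFn_smul c F))
  cont := continuous_setIntegral s

theorem setIntegralL1_toL1 (s : Set ℝ) {h : ℝ → ℂ} (hh : Integrable h) :
    setIntegralL1 s (hh.toL1 h) = ∫ x in s, h x :=
  integral_congr_ae (ae_restrict_of_ae hh.coeFn_toL1)

/-- In this form a continuous linear form on `L¹` can be moved under the integral defining the
resolvent. The two sides are compared by integrating over measurable sets and applying Fubini. -/
theorem integral_smul_expKernelTranslate (ψ : DL1) :
    ∫ x, ψ x • expKernelTranslate x = DL1.toL1 (DL1.resolvent ψ) := by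
  refine Lp.ext (Lp.ae_eq_of_forall_setIntegral_eq _ _ one_ne_zero ENNReal.one_ne_top
    (fun s _ _ => (L1.integrable_coeFn _).integrableOn)
    (fun s _ _ => (L1.integrable_coeFn _).integrableOn) fun s hs _ => ?_)
  change setIntegralL1 s _ = setIntegralL1 s ((DL1.resolvent ψ).integrable_self.toL1 _)
  rw [← ContinuousLinearMap.integral_comp_comm _
    (integrable_smul_expKernelTranslate ψ.integrable_self), setIntegralL1_toL1]
  simp only [map_smul, expKernelTranslate, setIntegralL1_toL1, smul_eq_mul, DL1.coe_resolvent,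
    expResolvent]
  rw [integral_integral_swap ((integrable_expKernel_sub_mul ψ.integrable_self).mono_measure
    (Measure.prod_mono Measure.restrict_le_self le_rfl))]
  simp only [integral_mul_const, mul_comm]

/-! ### Almost automorphic distributions and reduction of the order -/

namespace BoundedDistribution

/-- A bounded distribution is almost automorphic if its convolutions with test functions are. -/
def IsAlmostAutomorphic (T : BoundedDistribution) : Prop :=
  ∀ φ : 𝓓((⊤ : TopologicalSpace.Opens ℝ), ℂ), AlmostAutomorphic (T.conv φ)

theorem conv_apply (T : BoundedDistribution) (φ : 𝓓((⊤ : TopologicalSpace.Opens ℝ), ℂ)) (x : ℝ) :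
    T.conv φ x = T (DL1.subLeft x (DL1.ofTestFunction φ)) := rfl

theorem derivative_apply (T : BoundedDistribution) (ψ : DL1) :
    T.derivative ψ = -T (DL1.derivCLM ψ) := rfl

variable {T : BoundedDistribution}

/-- Test functions are dense and `subLeft x` preserves each norm, so approximating `χ` gives
approximation uniform in `x`. The extension beyond `D` is needed because the resolvent does not
preserve compact support. -/
theorem IsAlmostAutomorphic.subLeft (hT : T.IsAlmostAutomorphic) (χ : DL1) :
    AlmostAutomorphic fun x => T (DL1.subLeft x χ) := by
  obtain ⟨m, C, hC, h⟩ := DL1.exists_norm_apply_le T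
  refine AlmostAutomorphic.of_forall_exists_norm_sub_le fun ε hε => ?_
  obtain ⟨η, hη⟩ := χ.exists_testFunction_norm_sub_lt m (show 0 < ε / (C + 1) by positivity)
  refine ⟨_, hT η, fun x => ?_⟩
  rw [conv_apply, ← map_sub, ← DL1.subLeft_sub]
  refine (h _).trans ?_
  rw [DL1.norm_subLeft]
  calc C * DL1.norm m (χ - DL1.ofTestFunction η) ≤ (C + 1) * (ε / (C + 1)) :=
        mul_le_mul (by linarith) hη.le (apply_nonneg _ _) (by linarith)
    _ = ε := by field_simp

/-- `T' * φ = T * φ'`: the sign from duality cancels the one from reflection. -/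
theorem IsAlmostAutomorphic.derivative (hT : T.IsAlmostAutomorphic) :
    T.derivative.IsAlmostAutomorphic := fun φ => by
  refine (hT.subLeft (DL1.derivCLM (DL1.ofTestFunction φ))).congr fun x => ?_
  rw [conv_apply, derivative_apply, ← map_neg]
  congr 1
  refine DL1.ext fun y => ?_
  change deriv (DL1.ofTestFunction φ) (x - y) =
    -deriv (fun y => (DL1.ofTestFunction φ : ℝ → ℂ) (x - y)) y
  rw [deriv_comp_const_sub, neg_neg]

theorem IsAlmostAutomorphic.comp_resolvent (hT : T.IsAlmostAutomorphic) :
    IsAlmostAutomorphic (T.comp DL1.resolvent) := fun φ => by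
  refine (hT.subLeft (DL1.subLeft 0 (DL1.resolvent
    (DL1.subLeft 0 (DL1.ofTestFunction φ))))).congr fun x => ?_
  rw [conv_apply, ContinuousLinearMap.comp_apply, DL1.resolvent_subLeft x]

theorem IsAlmostAutomorphic.sum {ι : Type*} (s : Finset ι) {S : ι → BoundedDistribution}
    (hS : ∀ i, (S i).IsAlmostAutomorphic) : IsAlmostAutomorphic (∑ i ∈ s, S i) := fun φ => by
  refine (AlmostAutomorphic.sum s fun i => hS i φ).congr fun x => ?_
  simp [conv_apply]

theorem comp_resolvent_add_derivative (T : BoundedDistribution) :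
    T.comp DL1.resolvent + derivative (T.comp DL1.resolvent) = T := by
  refine ContinuousLinearMap.ext fun ψ => ?_
  rw [add_apply, derivative_apply, ← sub_eq_add_neg, ← map_sub,
    ContinuousLinearMap.comp_apply, DL1.resolvent_sub_derivCLM]

/-- For an almost automorphic distribution `T` of order zero, `(1 + d/dx)⁻¹ T` is an almost
automorphic function. -/
theorem IsAlmostAutomorphic.exists_comp_resolvent_eq (hT : T.IsAlmostAutomorphic) {C : ℝ}
    (hC : 0 ≤ C) (h : ∀ ψ, ‖T ψ‖ ≤ C * DL1.norm 0 ψ) :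
    ∃ (f : ℝ → ℂ) (hf : AlmostAutomorphic f), T.comp DL1.resolvent = hf.toDistribution := by
  let S : (ℝ →₁[volume] ℂ) →L[ℂ] ℂ := T.toLinearMap.extendOfNorm DL1.toL1
  have hn : ∀ ψ, ‖T.toLinearMap ψ‖ ≤ C * ‖DL1.toL1 ψ‖ := fun ψ => by
    rw [DL1.norm_toL1]
    exact h ψ
  have hS : ∀ ψ, S (DL1.toL1 ψ) = T ψ :=
    LinearMap.extendOfNorm_eq DL1.denseRange_toL1 ⟨C, hn⟩
  have hSn : ∀ F, ‖S F‖ ≤ C * ‖F‖ :=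
    LinearMap.norm_extendOfNorm_apply_le DL1.denseRange_toL1 C hn
  -- The discontinuous kernel is not in `D_{L¹}`, hence the extension `S`. Translates have constant
  -- `L¹` norm, so the approximation is uniform in `x`.
  have hf : AlmostAutomorphic fun x => S (expKernelTranslate x) := by
    refine AlmostAutomorphic.of_forall_exists_norm_sub_le fun ε hε => ?_
    obtain ⟨η, hη⟩ := exists_testFunction_integral_norm_sub_le integrable_expKernel
      (show 0 < ε / (C + 1) by positivity)
    refine ⟨_, hT η, fun x => ?_⟩
    rw [conv_apply, ← hS, ← map_sub]
    refine (hSn _).trans ?_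
    have hle : ‖expKernelTranslate x - DL1.toL1 (DL1.subLeft x (DL1.ofTestFunction η))‖ ≤
        ε / (C + 1) := by
      change ‖_ - Integrable.toL1 _ (DL1.subLeft x (DL1.ofTestFunction η)).integrable_self‖ ≤ _
      rw [expKernelTranslate, ← Integrable.toL1_sub, L1.norm_of_fun_eq_integral_norm]
      refine le_trans (le_of_eq ?_) hη
      exact integral_sub_left_eq_self (fun t => ‖expKernel t - η t‖) volume x
    calc C * _ ≤ (C + 1) * (ε / (C + 1)) :=
          mul_le_mul (by linarith) hle (norm_nonneg _) (by linarith)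
      _ = ε := by field_simp
  refine ⟨_, hf, ContinuousLinearMap.ext fun ψ => ?_⟩
  change T (DL1.resolvent ψ) = ∫ x, S (expKernelTranslate x) * ψ x
  rw [← hS, ← integral_smul_expKernelTranslate, ← ContinuousLinearMap.integral_comp_comm _
    (integrable_smul_expKernelTranslate ψ.integrable_self)]
  simp only [map_smul, smul_eq_mul, mul_comm]

/-- The derivative as a linear operator on bounded distributions. -/
def derivativeLM : Module.End ℂ BoundedDistribution where
  toFun := derivative
  map_add' S T := by
    refine ContinuousLinearMap.ext fun ψ => ?_
    simp only [derivative_apply, add_apply, neg_add]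
  map_smul' c T := by
    refine ContinuousLinearMap.ext fun ψ => ?_
    simp [derivative_apply]

theorem IsAlmostAutomorphic.exists_eq_pow_derivativeLM_add_one (hT : T.IsAlmostAutomorphic) :
    ∃ (n : ℕ) (f : ℝ → ℂ) (hf : AlmostAutomorphic f),
      T = ((derivativeLM + 1) ^ n) hf.toDistribution := by
  -- Each resolvent lowers the order by one, and a last one at order zero yields a function: hence
  -- `m + 1`. `T` and `C` vary, as the induction step applies to `T.comp DL1.resolvent` with a
  -- larger constant.
  have key : ∀ (m : ℕ) (T : BoundedDistribution) (C : ℝ), T.IsAlmostAutomorphic → 0 ≤ C →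
      (∀ ψ, ‖T ψ‖ ≤ C * DL1.norm m ψ) → ∃ (f : ℝ → ℂ) (hf : AlmostAutomorphic f),
        T = ((derivativeLM + 1) ^ (m + 1)) hf.toDistribution := by
    have hR : ∀ T : BoundedDistribution, T = (derivativeLM + 1) (T.comp DL1.resolvent) :=
      fun T => by
        nth_rewrite 1 [← comp_resolvent_add_derivative T]
        exact add_comm _ _
    intro m
    induction m with
    | zero =>
      intro T C hT hC h
      obtain ⟨f, hf, e⟩ := hT.exists_comp_resolvent_eq hC h
      exact ⟨f, hf, by rw [zero_add, pow_one, ← e]; exact hR T⟩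
    | succ m ih =>
      intro T C hT hC h
      obtain ⟨f, hf, e⟩ := ih (T.comp DL1.resolvent) (C * (2 * (m + 2))) hT.comp_resolvent
        (by positivity) fun ψ => by
          rw [mul_assoc]
          exact (h _).trans (mul_le_mul_of_nonneg_left (DL1.norm_succ_resolvent_le m ψ) hC)
      exact ⟨f, hf, by rw [pow_succ', Module.End.mul_apply, ← e]; exact hR T⟩
  obtain ⟨m, C, hC, h⟩ := DL1.exists_norm_apply_le T
  obtain ⟨f, hf, e⟩ := key m T C hT hC h
  exact ⟨m + 1, f, hf, e⟩

end BoundedDistribution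

/-! ### Distributions of almost automorphic functions, and the theorem -/

namespace AlmostAutomorphic

variable {f : ℝ → ℂ}

theorem toDistribution_const_mul (hf : AlmostAutomorphic f) (c : ℂ) :
    (hf.const_mul c).toDistribution = c • hf.toDistribution := by
  refine ContinuousLinearMap.ext fun ψ => ?_
  change ∫ x, c * f x * ψ x = c * ∫ x, f x * ψ x
  simp only [mul_assoc, integral_const_mul]

theorem isAlmostAutomorphic_toDistribution (hf : AlmostAutomorphic f) :
    hf.toDistribution.IsAlmostAutomorphic := fun φ => by
  refine (hf.convolution (DL1.ofTestFunction φ).integrable_self).congr fun x => ?_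
  change ∫ y, f (x - y) * φ y = ∫ y, f y * φ (x - y)
  rw [← integral_sub_left_eq_self _ volume x]
  simp

end AlmostAutomorphic

end

theorem mainTheorem2 (T : BoundedDistribution) :
    (∀ φ : 𝓓((⊤ : TopologicalSpace.Opens ℝ), ℂ), AlmostAutomorphic (T.conv φ)) ↔
      ∃ (k : ℕ) (f : Fin (k + 1) → ℝ → ℂ) (hf : ∀ j, AlmostAutomorphic (f j)),
        T = ∑ j : Fin (k + 1), BoundedDistribution.derivative^[(j : ℕ)] (hf j).toDistribution := by
  constructor
  · intro hT
    obtain ⟨n, f, hf, e⟩ :=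
      BoundedDistribution.IsAlmostAutomorphic.exists_eq_pow_derivativeLM_add_one hT
    -- The binomial expansion of `(d/dx + 1)^n f` makes every `f_j` a multiple of the same `f`.
    refine ⟨n, fun j x => (n.choose j : ℂ) * f x, fun j => hf.const_mul _, ?_⟩
    rw [e, (Commute.one_right BoundedDistribution.derivativeLM).add_pow, Finset.sum_range,
      LinearMap.sum_apply]
    refine Finset.sum_congr rfl fun j _ => ?_
    rw [one_pow, mul_one, Module.End.mul_apply, Module.End.natCast_apply, Module.End.pow_apply,
      hf.toDistribution_const_mul]
    exact congrArg _ (Nat.cast_smul_eq_nsmul ℂ _ hf.toDistribution).symm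
  · rintro ⟨k, f, hf, rfl⟩
    refine BoundedDistribution.IsAlmostAutomorphic.sum _ fun j => ?_
    -- The order of differentiation is detached from the index of `f j`, so that induction runs with
    -- `f j` fixed.
    generalize (j : ℕ) = i
    induction i with
    | zero => exact (hf j).isAlmostAutomorphic_toDistribution
    | succ i ih =>
      rw [Function.iterate_succ_apply']
      exact ih.derivative
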